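/- Let $i\ge 1$, $0\le m\le \ell<k$ and $d=2k-2+i\le n-1$ be integers, let $\mathbb F_q$ be a finite field, and put $\alpha=k-1+i$, $n'=n+i$. **Encoding matrix.** Let $\Phi$ be an $n'\times\alpha$ matrix over $\mathbb F_q$, $\Lambda=\mathrm{diag}(\lambda_1,\dots,\lambda_{n'})$ and $\Psi'=[\Phi\ \ \Lambda\Phi]$, such that (i) any $\alpha$ rows of $\Phi$ are linearly independent, (ii) any $2\alpha$ rows of $\Psi'$ are linearly independent, (iii) the $\lambda_j$ are distinct, and (iv) for each $c\in\{m,\,i-1,\,i,\,\ell+i-1,\,\ell+i\}$, any $c$ rows of $\Psi'$ restricted to its first $c$ columns are linearly independent. **Code.** Consider message matrices $M=\begin{bmatrix}S_1\\S_2\end{bmatrix}$ with symmetric $\alpha\times\alpha$ blocks $S_1,S_2$ over $\mathbb F_q$. In the $[n+i,k+i,d+i]$ product-matrix code of security level $\{\ell+i,m\}$, the random symbols are the entries in the first $\ell+i$ rows and columns of $S_1$, in the top-left $(\ell+i-1)\times(\ell+i-1)$ part of $S_2$, and in the first $m$ rows and columns of $S_2$; all other entries are message symbols. For the shortened code, the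 random symbols in the first $i$ rows and columns of $S_1$ and in the top-left $(i-1)\times(i-1)$ part of $S_2$ are not drawn at random but chosen, as functions of all other symbols, so that the first $i$ rows of $\Psi'M$ vanish. The remaining random symbols are independent, uniform on $\mathbb F_q$, and independent of the message, which has an arbitrary distribution. Node $j\in\{1,\dots,n\}$ stores row $i+j$ of $\Psi'M$ ($\alpha$ symbols). To repair node $f$, each of $d$ other nodes passes the inner product of its stored row with $\phi_f$, the row $i+f$ of $\Phi$. **Claim.** 1. The number of message symbols is $B^*=(k-\ell)(k-1+i-m)$. The symbols that are chosen deterministically are $i\alpha$ of the random symbols of the longer code, and $R^*=\ell\alpha+(k-\ell)m$ random symbols remain, so that $B^*+R^*=k\alpha$. 2. For all values of the message symbols and of the remaining random symbols, the deterministic choice exists and is unique. 3. The shortened code is an $[n,k,d]$ MSR code with $\beta=1$: the message can be recovered from the contents of any $k$ nodes, and the content of any node from the symbols passed by any $d$ other nodes. 4. The shortened code is $\{\ell,m\}$-secure: for every set $A$ of at most $\ell$ nodes and every $B\subseteq A$ of at most $m$ nodes, the contents of the nodes in $A$ together with all data passed during any repair operations of nodes in $B$ have zero mutual information with the message. 5.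 If $x_1,\dots,x_{n'}\in\mathbb F_q$ have distinct powers $x_j^\alpha$, then the Vandermonde choice with rows $(1,x_j,\dots,x_j^{2\alpha-1})$ of $\Psi'$ satisfies (i)–(iv). -/

import Mathlib

/-!
Write `φ_a` and `λ_a` for the row of `Φ` and the diagonal entry of `Λ` that belong to node `a`.

If two nodes `a ≠ b` store zero, then `φ_a S₁ φ_b + λ_a φ_a S₂ φ_b = 0`, and since the blocks are
symmetric also `φ_a S₁ φ_b + λ_b φ_a S₂ φ_b = 0`; as `λ_a ≠ λ_b`, both bilinear forms vanish at
`(φ_a, φ_b)`. By (i), `α + 1` such nodes force `S₁ = S₂ = 0`, which gives reconstruction from `k`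
nodes and the `i` removed ones. The symbol that node `a` passes for the repair of node `f` is the
inner product of row `a` of `Ψ'` with the vector `(φ_f S₁, φ_f S₂)`, so by (ii) the `d` helpers
and the `i` removed nodes determine this vector and hence the content of `f`.

Existence of the forced symbols and secrecy both come from one square linear system. Fix the
non-random symbols of level `{c, m}`, ask `c` nodes to store zero and `m` of these nodes `f` to
satisfy `φ_f S₂ = 0`. The first requirement already makes `φ_f S₂` orthogonal to `φ_e` for `c - 1`
nodes `e`, so the second one costs only `α + 1 - c` equations for each `f`, and
`c α + m (α + 1 - c)` is the number of random symbols. By (iv) the homogeneous system has only the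
zero solution, so there is exactly one solution. Level `{i, 0}` gives the forced symbols. Level
`{ℓ + i, m}` gives, for each message, random symbols for which the eavesdropper sees only zeros;
by linearity the law of what the eavesdropper sees is then the same for all messages.
-/


open MeasureTheory

namespace SecureMSR

/-- Positions of the free symbols of a message matrix `[S₁; S₂]` with symmetric `α × α` blocks:
`(0, s(a, b))` is the entry `(a, b)` (and `(b, a)`) of `S₁`, and `(1, s(a, b))` that of `S₂`.
Indices are 0-based. -/
abbrev Pos (α : ℕ) : Type := Fin 2 × Sym2 (Fin α)

section Code

variable {F : Type*} [Field F] {N α : ℕ}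

/-- The symmetric block `S₁` (for `t = 0`) or `S₂` (for `t = 1`). -/
def block (v : Pos α → F) (t : Fin 2) : Matrix (Fin α) (Fin α) F :=
  Matrix.of fun a b => v (t, s(a, b))

/-- The `2α × α` message matrix `M = [S₁; S₂]`. -/
def messageMatrix (v : Pos α → F) : Matrix (Fin α ⊕ Fin α) (Fin α) F :=
  Matrix.fromRows (block v 0) (block v 1)

/-- The `N × 2α` encoding matrix `Ψ = [Φ  ΛΦ]`, where `Λ = diag(lam)`. -/
def encodingMatrix (Φ : Matrix (Fin N) (Fin α) F) (lam : Fin N → F) :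
    Matrix (Fin N) (Fin α ⊕ Fin α) F :=
  Matrix.fromCols Φ (Matrix.diagonal lam * Φ)

/-- The code matrix `C = ΨM`; row `j` is the content of node `j`. -/
def codeMatrix (Φ : Matrix (Fin N) (Fin α) F) (lam : Fin N → F) (v : Pos α → F) :
    Matrix (Fin N) (Fin α) F :=
  encodingMatrix Φ lam * messageMatrix v

/-- The single symbol that helper node `j` passes for the repair of node `f`: the inner product
of the content of node `j` with the row `φ_f` of `Φ`. -/
def repairSymbol (Φ C : Matrix (Fin N) (Fin α) F) (f j : Fin N) : F :=
  C j ⬝ᵥ Φ f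

/-- Any `t` rows of `A` are linearly independent. -/
def AnyRowsIndep {m n : Type*} (A : Matrix m n F) (t : ℕ) : Prop :=
  ∀ s : Finset m, s.card = t → LinearIndependent F (fun r : s => A r)

/-- The restriction of `Φ` to its first `c` columns. -/
def firstCols (Φ : Matrix (Fin N) (Fin α) F) (c : ℕ) :
    Matrix (Fin N) {a : Fin α // (a : ℕ) < c} F :=
  Φ.submatrix id Subtype.val

/-- The requirements on the encoding matrix `Ψ' = [Φ  ΛΦ]` of the longer code, for the shortening
parameter `i` and the security level `{ℓ, m}` of the shortened code. -/
structure IsAdmissible (i ℓ m : ℕ) (Φ : Matrix (Fin N) (Fin α) F) (lam : Fin N → F) : Prop where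
  phi_indep : AnyRowsIndep Φ α
  psi_indep : AnyRowsIndep (encodingMatrix Φ lam) (2 * α)
  lam_injective : Function.Injective lam
  leading_indep : ∀ c ∈ ({m, i - 1, i, ℓ + i - 1, ℓ + i} : Set ℕ), AnyRowsIndep (firstCols Φ c) c

/-- The left half of the Vandermonde matrix with rows `(1, x_r, …, x_r ^ (2α - 1))`. -/
def vandermondePhi (α : ℕ) (x : Fin N → F) : Matrix (Fin N) (Fin α) F :=
  Matrix.of fun r c => x r ^ (c : ℕ)

end Code

section Positions

variable {α : ℕ}

/-- Positions filled by random symbols in the code of security level `{ℓ, m}`: the first `ℓ` rows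
and columns of `S₁`, the top-left `(ℓ-1) × (ℓ-1)` part of `S₂`, and the first `m` rows and columns
of `S₂`. -/
def IsRandomPos (ℓ m : ℕ) (p : Pos α) : Prop :=
  (p.1 = 0 ∧ ∃ a ∈ p.2, (a : ℕ) < ℓ) ∨
  (p.1 = 1 ∧ ((∀ a ∈ p.2, (a : ℕ) + 1 < ℓ) ∨ ∃ a ∈ p.2, (a : ℕ) < m))

/-- Positions whose symbols are chosen deterministically in the shortening by `i` nodes: the first
`i` rows and columns of `S₁` and the top-left `(i-1) × (i-1)` part of `S₂`. -/
def IsForcedPos (i : ℕ) (p : Pos α) : Prop :=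
  (p.1 = 0 ∧ ∃ a ∈ p.2, (a : ℕ) < i) ∨ (p.1 = 1 ∧ ∀ a ∈ p.2, (a : ℕ) + 1 < i)

/-- Message positions: the non-random positions of the code of level `{ℓ + i, m}`. -/
abbrev MsgPos (α i ℓ m : ℕ) : Type := {p : Pos α // ¬ IsRandomPos (ℓ + i) m p}

/-- Positions that stay random after the shortening. -/
abbrev RandPos (α i ℓ m : ℕ) : Type := {p : Pos α // IsRandomPos (ℓ + i) m p ∧ ¬ IsForcedPos i p}

/-- `v` is a filling of the message matrix that carries the message symbols `u` and the random
symbols `r`, and for which the first `i` of the `i + n` nodes store zero. -/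
structure IsShortenedFilling {F : Type*} [Field F] {n i ℓ m : ℕ}
    (Φ : Matrix (Fin (i + n)) (Fin α) F) (lam : Fin (i + n) → F)
    (u : MsgPos α i ℓ m → F) (r : RandPos α i ℓ m → F) (v : Pos α → F) : Prop where
  message : ∀ p : MsgPos α i ℓ m, v p = u p
  random : ∀ p : RandPos α i ℓ m, v p = r p
  zero : ∀ j : Fin i, codeMatrix Φ lam v (Fin.castAdd n j) = 0

/-- The encoding rows of the last `n` nodes, which are the nodes of the shortened code. -/
def lastRows {F : Type*} {n i : ℕ} (Φ : Matrix (Fin (i + n)) (Fin α) F) :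
    Matrix (Fin n) (Fin α) F :=
  Φ.submatrix (Fin.natAdd i) id

/-- The code matrix `C* = Ψ* M*` of the shortened code: `Ψ*` consists of the last `n` rows of
`Ψ' = [Φ  ΛΦ]`, and `M*` is the message matrix with entries `v`. -/
def shortenedCodeMatrix {F : Type*} [Field F] {n i : ℕ}
    (Φ : Matrix (Fin (i + n)) (Fin α) F) (lam : Fin (i + n) → F) (v : Pos α → F) :
    Matrix (Fin n) (Fin α) F :=
  codeMatrix (lastRows Φ) (fun j => lam (Fin.natAdd i j)) v

end Positions

section Model

variable {F : Type*} [Field F] {n α : ℕ} {P Q : Type*}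

/-- Data reconstruction: the message can be recovered from the contents of any `k` nodes.
Here `C u r` is the code matrix for the message `u` and the random symbols `r`. -/
def Reconstructs (k : ℕ) (C : (P → F) → (Q → F) → Matrix (Fin n) (Fin α) F) : Prop :=
  ∀ K : Finset (Fin n), K.card = k →
    ∃ dec : (K → Fin α → F) → (P → F), ∀ u r, dec (fun j => C u r j) = u

/-- Node repair: the content of any node can be recovered from one symbol from each of any `d`
other nodes. -/
def Repairs (d : ℕ) (Φ : Matrix (Fin n) (Fin α) F)
    (C : (P → F) → (Q → F) → Matrix (Fin n) (Fin α) F) : Prop :=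
  ∀ (f : Fin n) (H : Finset (Fin n)), f ∉ H → H.card = d →
    ∃ rec : (H → F) → (Fin α → F), ∀ u r, rec (fun h => repairSymbol Φ (C u r) f h) = C u r f

/-- What an eavesdropper sees who reads the contents of the nodes in `A` and all the symbols passed
in the repair operations in `T`; the pair `(f, H)` is the repair of node `f` by the helpers `H`. -/
def view (Φ : Matrix (Fin n) (Fin α) F) (A : Finset (Fin n))
    (T : Finset (Fin n × Finset (Fin n))) (C : Matrix (Fin n) (Fin α) F) :
    (A → Fin α → F) × ((t : T) → t.1.2 → F) :=
  (fun a => C a, fun t h => repairSymbol Φ C t.1.1 h)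

/-- Mutual information `I(X; Y)` (in nats): the Kullback–Leibler divergence of the joint law from
the product of the marginal laws. -/
noncomputable def mutualInfo {Ω X Y : Type*} [MeasurableSpace Ω] [MeasurableSpace X]
    [MeasurableSpace Y] (μ : Measure Ω) (f : Ω → X) (g : Ω → Y) : ENNReal :=
  InformationTheory.klDiv (μ.map fun ω => (f ω, g ω)) ((μ.map f).prod (μ.map g))

/-- `{ℓ, m}`-security from the passive eavesdropper: for every law `ν` of the message, with the
random symbols uniform and independent of the message, an eavesdropper who reads the contents of a
set `A` of at most `ℓ` nodes and all the data passed in any repair operations (each with `d`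
helpers) of nodes in a set `B ⊆ A` of at most `m` nodes has zero mutual information with the
message. -/
def IsSecure [MeasurableSpace F] (ℓ m d : ℕ) (Φ : Matrix (Fin n) (Fin α) F)
    (C : (P → F) → (Q → F) → Matrix (Fin n) (Fin α) F) : Prop :=
  ∀ (A B : Finset (Fin n)) (T : Finset (Fin n × Finset (Fin n))),
    A.card ≤ ℓ → B ⊆ A → B.card ≤ m →
    (∀ t ∈ T, t.1 ∈ B ∧ t.1 ∉ t.2 ∧ t.2.card = d) →
    ∀ ν : Measure (P → F), IsProbabilityMeasure ν →
      mutualInfo (ν.prod (ProbabilityTheory.uniformOn (Set.univ : Set (Q → F))))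
        (fun ω => ω.1) (fun ω => view Φ A T (C ω.1 ω.2)) = 0

end Model

end SecureMSR

open SecureMSR

namespace SecureMSR

section Independence

variable {F : Type*} [Field F] {N α : ℕ}

lemma AnyRowsIndep.eq_zero_of_dotProduct {m n : Type*} [Fintype n] {A : Matrix m n F} {t : ℕ}
    (hA : AnyRowsIndep A t) (ht : Fintype.card n = t) {s : Finset m} (hs : s.card = t)
    {w : n → F} (hw : ∀ a ∈ s, A a ⬝ᵥ w = 0) : w = 0 := by
  have hspan := (hA s hs).span_eq_top_of_card_eq_finrank' (by simp [hs, ht])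
  have hker : ⊤ ≤ LinearMap.ker ((dotProductBilin F F).flip w) := by
    rw [← hspan, Submodule.span_le]
    rintro _ ⟨a, rfl⟩
    exact hw a a.2
  refine dotProduct_eq_zero w fun x => ?_
  rw [dotProduct_comm]
  exact hker (x := x) trivial

lemma firstCols_dotProduct {c : ℕ} (Φ : Matrix (Fin N) (Fin α) F) (a : Fin N) {w : Fin α → F}
    (hsupp : ∀ b : Fin α, c ≤ b → w b = 0) : (firstCols Φ c a ⬝ᵥ fun b => w b) = Φ a ⬝ᵥ w :=
  Fintype.sum_of_injective Subtype.val Subtype.val_injective _ _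
    (fun b hb => by rw [hsupp b (by simpa using hb), mul_zero]) fun _ => rfl

lemma AnyRowsIndep.eq_zero_of_firstCols {Φ : Matrix (Fin N) (Fin α) F} {c : ℕ} (hc : c ≤ α)
    (h : AnyRowsIndep (firstCols Φ c) c) {s : Finset (Fin N)} (hs : s.card = c) {w : Fin α → F}
    (hsupp : ∀ b : Fin α, c ≤ b → w b = 0) (hw : ∀ a ∈ s, Φ a ⬝ᵥ w = 0) : w = 0 := by
  have hcard : Fintype.card {a : Fin α // (a : ℕ) < c} = c := by
    rw [← Fintype.card_congr (Fin.castLEOrderIso hc).toEquiv, Fintype.card_fin]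
  have hfirst := h.eq_zero_of_dotProduct hcard hs fun a ha =>
    (firstCols_dotProduct Φ a hsupp).trans (hw a ha)
  funext b
  rcases lt_or_ge (b : ℕ) c with hb | hb
  · exact congrFun hfirst ⟨b, hb⟩
  · exact hsupp b hb

lemma anyRowsIndep_zero {m n : Type*} (A : Matrix m n F) : AnyRowsIndep A 0 := by
  intro s hs
  obtain rfl := Finset.card_eq_zero.1 hs
  exact linearIndependent_empty_type

lemma anyRowsIndep_of_pow {m n : Type*} {A : Matrix m n F} {t : ℕ} (e : n ≃ Fin t) {x : m → F}
    (hx : Function.Injective x) (hA : ∀ a j, A a j = x a ^ (e j : ℕ)) : AnyRowsIndep A t := by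
  intro s hs
  have σ : Fin t ≃ s := (s.equivFinOfCardEq hs).symm
  have hdet : (Matrix.vandermonde fun y => x (σ y)).det ≠ 0 :=
    Matrix.det_vandermonde_ne_zero_iff.2 (hx.comp (Subtype.val_injective.comp σ.injective))
  have hli := (Matrix.linearIndependent_rows_of_det_ne_zero hdet).map'
    (LinearEquiv.funCongrLeft F F e).toLinearMap (LinearEquiv.ker _)
  have hrows : (fun a : s => A a) ∘ σ =
      (LinearEquiv.funCongrLeft F F e).toLinearMap ∘
        (Matrix.vandermonde fun y => x (σ y)).row :=
    funext fun y => funext fun j => hA (σ y) j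
  rw [← linearIndependent_equiv σ, hrows]
  exact hli

variable {i ℓ m : ℕ} {Φ : Matrix (Fin N) (Fin α) F} {lam : Fin N → F}

lemma IsAdmissible.longer (h : IsAdmissible i ℓ m Φ lam) : IsAdmissible 0 (ℓ + i) m Φ lam where
  phi_indep := h.phi_indep
  psi_indep := h.psi_indep
  lam_injective := h.lam_injective
  leading_indep := by
    rintro c (rfl | rfl | rfl | rfl | rfl)
    · exact h.leading_indep _ (by simp)
    · exact anyRowsIndep_zero _
    · exact anyRowsIndep_zero _
    · exact h.leading_indep _ (by simp)
    · exact h.leading_indep _ (by simp)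

lemma IsAdmissible.forced (h : IsAdmissible i ℓ m Φ lam) : IsAdmissible 0 i 0 Φ lam where
  phi_indep := h.phi_indep
  psi_indep := h.psi_indep
  lam_injective := h.lam_injective
  leading_indep := by
    rintro c (rfl | rfl | rfl | rfl | rfl)
    · exact anyRowsIndep_zero _
    · exact anyRowsIndep_zero _
    · exact anyRowsIndep_zero _
    · exact h.leading_indep _ (by simp)
    · exact h.leading_indep _ (by simp)

lemma vandermonde_isAdmissible (hm : m ≤ ℓ) (hα : ℓ + i ≤ α) {x : Fin N → F}
    (hx : Function.Injective fun j => x j ^ α) :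
    IsAdmissible i ℓ m (vandermondePhi α x) (fun j => x j ^ α) := by
  have hinj : Function.Injective x := fun a b hab => hx (by simp only [hab])
  refine ⟨anyRowsIndep_of_pow (Equiv.refl _) hinj fun a j => rfl, ?_, hx, fun c hc => ?_⟩
  · rw [two_mul]
    refine anyRowsIndep_of_pow finSumFinEquiv hinj fun a j => ?_
    rcases j with j | j
    · simp [encodingMatrix, vandermondePhi]
    · simp [encodingMatrix, vandermondePhi, Matrix.diagonal_mul, pow_add, mul_comm]
  · have hcα : c ≤ α := by
      simp only [Set.mem_insert_iff, Set.mem_singleton_iff] at hc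
      omega
    exact anyRowsIndep_of_pow (Fin.castLEOrderIso hcα).symm.toEquiv hinj fun a j => rfl

end Independence

section MessageMatrix

lemma block_comm {F : Type*} {α : ℕ} (v : Pos α → F) (t : Fin 2) (a b : Fin α) :
    block v t a b = block v t b a :=
  congrArg (fun z => v (t, z)) Sym2.eq_swap

variable {F : Type*} [Field F] {N α : ℕ}

lemma eq_zero_of_block_eq_zero {v : Pos α → F} (h : ∀ t, block v t = 0) : v = 0 := by
  funext ⟨t, z⟩
  induction z with
  | _ a b => exact congrFun (congrFun (h t) a) b

/-- The row vector `x S₁` (for `t = 0`) or `x S₂` (for `t = 1`), as a linear function of the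
entries of the message matrix. -/
def vecMulBlock (x : Fin α → F) (t : Fin 2) : (Pos α → F) →ₗ[F] (Fin α → F) where
  toFun v := Matrix.vecMul x (block v t)
  map_add' _ _ := Matrix.vecMul_add _ _ _
  map_smul' _ _ := Matrix.vecMul_smul _ _ _

/-- The content `φ_a S₁ + λ_a φ_a S₂` of node `a`, as a linear function of the entries of the
message matrix. -/
def nodeContent (Φ : Matrix (Fin N) (Fin α) F) (lam : Fin N → F) (a : Fin N) :
    (Pos α → F) →ₗ[F] (Fin α → F) :=
  vecMulBlock (Φ a) 0 + lam a • vecMulBlock (Φ a) 1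

lemma codeMatrix_row (Φ : Matrix (Fin N) (Fin α) F) (lam : Fin N → F) (v : Pos α → F)
    (a : Fin N) : codeMatrix Φ lam v a = nodeContent Φ lam a v := by
  funext j
  rw [codeMatrix, encodingMatrix, messageMatrix, Matrix.fromCols_mul_fromRows, Matrix.mul_assoc,
    Matrix.add_apply, Matrix.diagonal_mul]
  rfl

lemma vecMulBlock_dotProduct_comm (x y : Fin α → F) (t : Fin 2) (v : Pos α → F) :
    vecMulBlock x t v ⬝ᵥ y = vecMulBlock y t v ⬝ᵥ x := by
  have hsymm : (block v t).transpose = block v t := Matrix.ext fun a b => block_comm v t b a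
  change Matrix.vecMul x (block v t) ⬝ᵥ y = Matrix.vecMul y (block v t) ⬝ᵥ x
  rw [← Matrix.dotProduct_mulVec, dotProduct_comm, ← Matrix.vecMul_transpose, hsymm]

lemma nodeContent_dotProduct (Φ : Matrix (Fin N) (Fin α) F) (lam : Fin N → F) (a : Fin N)
    (v : Pos α → F) (y : Fin α → F) :
    nodeContent Φ lam a v ⬝ᵥ y =
      vecMulBlock (Φ a) 0 v ⬝ᵥ y + lam a * (vecMulBlock (Φ a) 1 v ⬝ᵥ y) := by
  simp only [nodeContent, LinearMap.add_apply, LinearMap.smul_apply, add_dotProduct,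
    smul_dotProduct, smul_eq_mul]

lemma nodeContent_dotProduct_eq_encodingMatrix_dotProduct (Φ : Matrix (Fin N) (Fin α) F)
    (lam : Fin N → F) (a : Fin N) (v : Pos α → F) (y : Fin α → F) :
    nodeContent Φ lam a v ⬝ᵥ y =
      encodingMatrix Φ lam a ⬝ᵥ Sum.elim (vecMulBlock y 0 v) (vecMulBlock y 1 v) := by
  rw [nodeContent_dotProduct, vecMulBlock_dotProduct_comm, vecMulBlock_dotProduct_comm (Φ a) y 1,
    dotProduct_comm, dotProduct_comm _ (Φ a)]
  simp [dotProduct, encodingMatrix, Matrix.diagonal_mul, Finset.mul_sum, mul_assoc]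

variable {Φ : Matrix (Fin N) (Fin α) F} {lam : Fin N → F} {v : Pos α → F}

lemma nodeContent_eq_zero_of_repair (hΨ : AnyRowsIndep (encodingMatrix Φ lam) (2 * α))
    {s : Finset (Fin N)} (hs : s.card = 2 * α) {f : Fin N}
    (hzero : ∀ a ∈ s, nodeContent Φ lam a v ⬝ᵥ Φ f = 0) : nodeContent Φ lam f v = 0 := by
  have hw := hΨ.eq_zero_of_dotProduct (by simp [two_mul]) hs fun a ha =>
    (nodeContent_dotProduct_eq_encodingMatrix_dotProduct Φ lam a v (Φ f)).symm.trans (hzero a ha)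
  have hrow₁ : vecMulBlock (Φ f) 0 v = 0 := funext fun j => congrFun hw (Sum.inl j)
  have hrow₂ : vecMulBlock (Φ f) 1 v = 0 := funext fun j => congrFun hw (Sum.inr j)
  simp only [nodeContent, LinearMap.add_apply, LinearMap.smul_apply, hrow₁, hrow₂, smul_zero,
    add_zero]

lemma vecMulBlock_dotProduct_eq_zero (hlam : Function.Injective lam) {a b : Fin N} (hab : a ≠ b)
    (ha : nodeContent Φ lam a v = 0) (hb : nodeContent Φ lam b v = 0) (t : Fin 2) :
    vecMulBlock (Φ a) t v ⬝ᵥ Φ b = 0 := by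
  have hab₀ := nodeContent_dotProduct Φ lam a v (Φ b)
  have hba₀ := nodeContent_dotProduct Φ lam b v (Φ a)
  rw [ha, zero_dotProduct] at hab₀
  rw [hb, zero_dotProduct, vecMulBlock_dotProduct_comm (Φ b), vecMulBlock_dotProduct_comm (Φ b)]
    at hba₀
  have hS₂ : vecMulBlock (Φ a) 1 v ⬝ᵥ Φ b = 0 := by
    refine (mul_eq_zero.1 ?_).resolve_left (sub_ne_zero.2 (hlam.ne hab))
    linear_combination hba₀ - hab₀
  have hS₁ : vecMulBlock (Φ a) 0 v ⬝ᵥ Φ b = 0 := by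
    rwa [hS₂, mul_zero, add_zero, eq_comm] at hab₀
  fin_cases t
  · exact hS₁
  · exact hS₂

lemma eq_zero_of_nodeContent_eq_zero (hΦ : AnyRowsIndep Φ α) (hlam : Function.Injective lam)
    {R : Finset (Fin N)} (hR : R.card = α + 1) (hzero : ∀ a ∈ R, nodeContent Φ lam a v = 0) :
    v = 0 := by
  refine eq_zero_of_block_eq_zero fun t => ?_
  have hrow : ∀ a ∈ R, vecMulBlock (Φ a) t v = 0 := fun a ha =>
    hΦ.eq_zero_of_dotProduct (Fintype.card_fin α) (s := R.erase a)
      (by rw [Finset.card_erase_of_mem ha, hR, Nat.add_sub_cancel]) fun b hb => by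
        rw [dotProduct_comm]
        exact vecMulBlock_dotProduct_eq_zero hlam (Finset.ne_of_mem_erase hb).symm (hzero a ha)
          (hzero b (Finset.mem_of_mem_erase hb)) t
  obtain ⟨s, hsR, hs⟩ := Finset.exists_subset_card_eq (s := R) (n := α) (by omega)
  ext a j
  exact congrFun (hΦ.eq_zero_of_dotProduct (Fintype.card_fin α) hs (w := fun b => block v t b j)
    fun b hb => congrFun (hrow b (hsR hb)) j) a

/-- The relations in `horth` are completed to `α` by one for each other node in `R`. -/
lemma vecMulBlock_eq_zero_of_orthogonal (hΦ : AnyRowsIndep Φ α) (hlam : Function.Injective lam)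
    {R E : Finset (Fin N)} (hE : Disjoint R E) (hcard : R.card + E.card = α + 1)
    (hzero : ∀ a ∈ R, nodeContent Φ lam a v = 0) {f : Fin N} (hf : f ∈ R)
    (horth : ∀ e ∈ E, Φ e ⬝ᵥ vecMulBlock (Φ f) 1 v = 0) : vecMulBlock (Φ f) 1 v = 0 := by
  have hcard' : (R.erase f ∪ E).card = α := by
    rw [Finset.card_union_of_disjoint (hE.mono_left (Finset.erase_subset _ _)),
      Finset.card_erase_of_mem hf]
    have := Finset.card_pos.2 ⟨f, hf⟩
    omega
  refine hΦ.eq_zero_of_dotProduct (Fintype.card_fin α) hcard' fun b hb => ?_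
  rcases Finset.mem_union.1 hb with hb | hb
  · rw [dotProduct_comm]
    exact vecMulBlock_dotProduct_eq_zero hlam (Finset.ne_of_mem_erase hb).symm (hzero f hf)
      (hzero b (Finset.mem_of_mem_erase hb)) 1
  · exact horth b hb

lemma vecMulBlock_zero_eq_zero {a : Fin N} (hzero : nodeContent Φ lam a v = 0)
    (hS₂ : vecMulBlock (Φ a) 1 v = 0) : vecMulBlock (Φ a) 0 v = 0 := by
  simpa only [nodeContent, LinearMap.add_apply, LinearMap.smul_apply, hS₂, smul_zero, add_zero]
    using hzero

lemma nodeContent_dotProduct_eq_zero {f : Fin N} (hzero : nodeContent Φ lam f v = 0)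
    (hS₂ : vecMulBlock (Φ f) 1 v = 0) (a : Fin N) : nodeContent Φ lam a v ⬝ᵥ Φ f = 0 := by
  rw [nodeContent_dotProduct, vecMulBlock_dotProduct_comm, vecMulBlock_zero_eq_zero hzero hS₂,
    vecMulBlock_dotProduct_comm _ _ 1, hS₂, zero_dotProduct, mul_zero, add_zero]

lemma block_col_eq_zero {c : ℕ} (hc : c ≤ α) (h : AnyRowsIndep (firstCols Φ c) c)
    {s : Finset (Fin N)} (hs : s.card = c) {t : Fin 2} (hrow : ∀ a ∈ s, vecMulBlock (Φ a) t v = 0)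
    {j : Fin α} (hsupp : ∀ a : Fin α, c ≤ a → block v t a j = 0) (a : Fin α) :
    block v t a j = 0 :=
  congrFun (h.eq_zero_of_firstCols hc hs (w := fun b => block v t b j) hsupp
    fun b hb => congrFun (hrow b hb) j) a

lemma block_eq_zero_of_firstCols {c : ℕ} (hc : c ≤ α) (h : AnyRowsIndep (firstCols Φ c) c)
    {s : Finset (Fin N)} (hs : s.card = c) {t : Fin 2} (hrow : ∀ a ∈ s, vecMulBlock (Φ a) t v = 0)
    (hsupp : ∀ a b : Fin α, c ≤ a → c ≤ b → block v t a b = 0) : block v t = 0 := by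
  have hright : ∀ j : Fin α, c ≤ j → ∀ a, block v t a j = 0 := fun j hj =>
    block_col_eq_zero hc h hs hrow fun a ha => hsupp a j ha hj
  ext a j
  exact block_col_eq_zero hc h hs hrow
    (fun b hb => (block_comm v t b j).trans (hright b hb j)) a

end MessageMatrix

section Counting

variable {α : ℕ}

lemma isRandomPos_zero_iff {c m : ℕ} {a b : Fin α} :
    IsRandomPos c m (0, s(a, b)) ↔ (a : ℕ) < c ∨ (b : ℕ) < c := by
  simp [IsRandomPos]

lemma isRandomPos_one_iff {c m : ℕ} {a b : Fin α} :
    IsRandomPos c m (1, s(a, b)) ↔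
      ((a : ℕ) + 1 < c ∧ (b : ℕ) + 1 < c) ∨ (a : ℕ) < m ∨ (b : ℕ) < m := by
  simp [IsRandomPos]

lemma card_sym2_forall_mem_Ico {x y : ℕ} (hy : y ≤ α) :
    (Finset.univ.filter fun z : Sym2 (Fin α) => ∀ a ∈ z, (a : ℕ) ∈ Finset.Ico x y).card =
      (y - x + 1).choose 2 := by
  have hlt : ∀ a ∈ Finset.Ico x y, a < α := fun a ha => (Finset.mem_Ico.1 ha).2.trans_le hy
  rw [← Nat.card_Ico, ← Finset.card_attachFin _ hlt, ← Finset.card_sym2]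
  congr 1
  ext z
  simp only [Finset.mem_filter, Finset.mem_univ, true_and, Finset.mem_sym2_iff,
    Finset.mem_attachFin]

open Classical in
lemma card_not_isRandomPos_zero (c m : ℕ) :
    (Finset.univ.filter fun z : Sym2 (Fin α) => ¬ IsRandomPos c m (0, z)).card =
      (α - c + 1).choose 2 := by
  rw [← card_sym2_forall_mem_Ico le_rfl]
  congr 1
  ext z
  simp [IsRandomPos]

open Classical in
lemma card_not_isRandomPos_one {c m : ℕ} (hmc : m ≤ c) (hcα : c ≤ α) :
    (Finset.univ.filter fun z : Sym2 (Fin α) => ¬ IsRandomPos c m (1, z)).card =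
      (α - m + 1).choose 2 - (c - m).choose 2 := by
  have hsmall : (c - m).choose 2 = (c - 1 - m + 1).choose 2 := by
    rcases hmc.eq_or_lt with rfl | hmc
    · rw [Nat.sub_self, Nat.sub_right_comm, Nat.sub_self]
      rfl
    · congr 1
      omega
  rw [hsmall, ← card_sym2_forall_mem_Ico (x := m) (y := α) le_rfl,
    ← card_sym2_forall_mem_Ico (α := α) (x := m) (y := c - 1) (by omega),
    ← Finset.card_sdiff_of_subset]
  · congr 1
    ext z
    induction z with
    | _ a b =>
      simp only [isRandomPos_one_iff, Finset.mem_sdiff, Finset.mem_filter, Finset.mem_univ,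
        true_and, Sym2.ball, Finset.mem_Ico]
      omega
  · intro z
    simp +contextual

lemma choose_two_add_choose_two_sub (a b : ℕ) :
    (b + 1).choose 2 + ((a + b + 1).choose 2 - a.choose 2) = (a + b) * (b + 1) := by
  have hle : a.choose 2 ≤ (a + b + 1).choose 2 := Nat.choose_le_choose 2 (by omega)
  have key : (((b + 1).choose 2 + ((a + b + 1).choose 2 - a.choose 2) : ℕ) : ℚ) =
      ((a + b) * (b + 1) : ℕ) := by
    rw [Nat.cast_add, Nat.cast_sub hle, Nat.cast_choose_two, Nat.cast_choose_two,
      Nat.cast_choose_two]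
    push_cast
    ring
  exact_mod_cast key

lemma card_not_isRandomPos {c m : ℕ} (hmc : m ≤ c) (hcα : c ≤ α) :
    Nat.card {p : Pos α // ¬ IsRandomPos c m p} = (α + 1 - c) * (α - m) := by
  classical
  rw [Nat.card_eq_fintype_card, Fintype.card_subtype, Finset.card_filter, Fintype.sum_prod_type,
    Fin.sum_univ_two, ← Finset.card_filter, ← Finset.card_filter, card_not_isRandomPos_zero,
    card_not_isRandomPos_one hmc hcα]
  obtain ⟨a, rfl⟩ := Nat.exists_eq_add_of_le hmc
  obtain ⟨b, rfl⟩ := Nat.exists_eq_add_of_le hcα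
  convert choose_two_add_choose_two_sub a b using 1
  · congr <;> omega
  · rw [mul_comm]
    congr 1 <;> omega

lemma card_positions : Nat.card (Pos α) = α * (α + 1) := by
  rw [Nat.card_eq_fintype_card, Fintype.card_prod, Fintype.card_fin, Sym2.card, Fintype.card_fin,
    Nat.choose_two_right, Nat.add_sub_cancel, mul_comm 2, Nat.div_mul_cancel, mul_comm]
  exact (Nat.even_mul_pred_self (α + 1)).two_dvd

lemma card_isRandomPos_add_card_not_isRandomPos (c m : ℕ) :
    Nat.card {p : Pos α // IsRandomPos c m p} + Nat.card {p : Pos α // ¬ IsRandomPos c m p} =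
      Nat.card (Pos α) := by
  classical
  rw [← Nat.card_sum, Nat.card_congr (Equiv.sumCompl _)]

lemma card_isRandomPos {c m : ℕ} (hmc : m ≤ c) (hcα : c ≤ α) :
    Nat.card {p : Pos α // IsRandomPos c m p} = c * α + (α + 1 - c) * m := by
  have htotal := card_isRandomPos_add_card_not_isRandomPos (α := α) c m
  rw [card_not_isRandomPos hmc hcα, card_positions] at htotal
  obtain ⟨x, hx⟩ := Nat.exists_eq_add_of_le (hmc.trans hcα)
  obtain ⟨y, hy⟩ : ∃ y, α + 1 = c + y := ⟨α + 1 - c, by omega⟩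
  rw [hy, Nat.add_sub_cancel_left] at htotal ⊢
  rw [hx, Nat.add_sub_cancel_left] at htotal
  rw [hx]
  linarith

lemma isForcedPos_iff_isRandomPos {i : ℕ} {p : Pos α} : IsForcedPos i p ↔ IsRandomPos i 0 p := by
  simp [IsForcedPos, IsRandomPos]

lemma card_isForcedPos {i : ℕ} (hi : i ≤ α) : Nat.card {p : Pos α // IsForcedPos i p} = i * α := by
  simpa only [isForcedPos_iff_isRandomPos, mul_zero, add_zero] using
    card_isRandomPos (Nat.zero_le i) hi

lemma IsForcedPos.isRandomPos {i : ℕ} {p : Pos α} (h : IsForcedPos i p) (ℓ m : ℕ) :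
    IsRandomPos (ℓ + i) m p := by
  rcases h with ⟨h, a, ha, hlt⟩ | ⟨h, hall⟩
  · exact Or.inl ⟨h, a, ha, by omega⟩
  · exact Or.inr ⟨h, Or.inl fun a ha => by have := hall a ha; omega⟩

lemma card_randPos {i ℓ m : ℕ} (hm : m ≤ ℓ) (hα : ℓ + i ≤ α) :
    Nat.card (RandPos α i ℓ m) = ℓ * α + (α + 1 - (ℓ + i)) * m := by
  have hsplit : Nat.card (RandPos α i ℓ m) + Nat.card {p : Pos α // IsForcedPos i p} =
      Nat.card {p : Pos α // IsRandomPos (ℓ + i) m p} :=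
    Set.ncard_sdiff_add_ncard_of_subset (s := {p : Pos α | IsForcedPos i p})
      (t := {p : Pos α | IsRandomPos (ℓ + i) m p}) fun p hp => hp.isRandomPos ℓ m
  rw [card_isForcedPos (by omega), card_isRandomPos (by omega) hα] at hsplit
  linarith

end Counting

section Filling

variable {F : Type*} [Field F] {N α c m : ℕ} {Φ : Matrix (Fin N) (Fin α) F} {lam : Fin N → F}

lemma block_one_eq_zero_of_isRandomPos (h : IsAdmissible 0 c m Φ lam) (hmc : m ≤ c) (hcα : c ≤ α)
    {R B : Finset (Fin N)} (hR : R.card = c) (hB : B.card = m) {v : Pos α → F}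
    (hsupp : ∀ p, ¬ IsRandomPos c m p → v p = 0) (hzero : ∀ a ∈ R, nodeContent Φ lam a v = 0)
    (hrowB : ∀ f ∈ B, vecMulBlock (Φ f) 1 v = 0) : block v 1 = 0 := by
  have hindep_m : AnyRowsIndep (firstCols Φ m) m := h.leading_indep m (by simp)
  rcases hmc.eq_or_lt with rfl | hmc
  · exact block_eq_zero_of_firstCols hcα hindep_m hB hrowB fun a b ha hb =>
      hsupp _ (by rw [isRandomPos_one_iff]; omega)
  have hindep : AnyRowsIndep (firstCols Φ (c - 1)) (c - 1) := h.leading_indep _ (by simp)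
  have hcol : ∀ j : Fin α, c - 1 ≤ j → ∀ a, block v 1 a j = 0 := fun j hj =>
    block_col_eq_zero (by omega) hindep_m hB hrowB fun a ha =>
      hsupp _ (by rw [isRandomPos_one_iff]; omega)
  have hrow : ∀ a ∈ R, vecMulBlock (Φ a) 1 v = 0 := fun a ha => by
    refine hindep.eq_zero_of_firstCols (by omega) (s := R.erase a)
      (by rw [Finset.card_erase_of_mem ha, hR]) (fun j hj => ?_) fun b hb => ?_
    · exact (congrArg (Φ a ⬝ᵥ ·) (funext (hcol j hj))).trans (dotProduct_zero (Φ a))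
    · rw [dotProduct_comm]
      exact vecMulBlock_dotProduct_eq_zero h.lam_injective (Finset.ne_of_mem_erase hb).symm
        (hzero a ha) (hzero b (Finset.mem_of_mem_erase hb)) 1
  obtain ⟨s, hsR, hs⟩ := Finset.exists_subset_card_eq (s := R) (n := c - 1) (by omega)
  exact block_eq_zero_of_firstCols (by omega) hindep hs (fun a ha => hrow a (hsR ha))
    fun a b _ hb => hcol b hb a

lemma eq_zero_of_isRandomPos (h : IsAdmissible 0 c m Φ lam) (hmc : m ≤ c) (hcα : c ≤ α)
    {R B : Finset (Fin N)} (hR : R.card = c) (hB : B.card = m) {v : Pos α → F}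
    (hsupp : ∀ p, ¬ IsRandomPos c m p → v p = 0) (hzero : ∀ a ∈ R, nodeContent Φ lam a v = 0)
    (hrowB : ∀ f ∈ B, vecMulBlock (Φ f) 1 v = 0) : v = 0 := by
  have hS₂ := block_one_eq_zero_of_isRandomPos h hmc hcα hR hB hsupp hzero hrowB
  have hrow : ∀ a ∈ R, vecMulBlock (Φ a) 0 v = 0 := fun a ha =>
    vecMulBlock_zero_eq_zero (hzero a ha)
      ((congrArg (Matrix.vecMul (Φ a)) hS₂).trans (Matrix.vecMul_zero (Φ a)))
  have hS₁ : block v 0 = 0 :=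
    block_eq_zero_of_firstCols hcα (h.leading_indep c (by simp)) hR hrow fun a b ha hb =>
      hsupp _ (by rw [isRandomPos_zero_iff]; omega)
  exact eq_zero_of_block_eq_zero (Fin.forall_fin_two.2 ⟨hS₁, hS₂⟩)

/-- The contents of the nodes in `R`, the products `φ_f S₂ φ_e` for `f ∈ B` and `e ∈ E`, and the
symbols at the positions in `P`, as linear functions of the entries of the message matrix. For
`|R| = c`, `|B| = m`, `|E| = α + 1 - c` and `P` the non-random positions of level `{c, m}`, there
are as many of these as positions. -/
def observationMap (Φ : Matrix (Fin N) (Fin α) F) (lam : Fin N → F) (R B E : Finset (Fin N))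
    (P : Pos α → Prop) :
    (Pos α → F) →ₗ[F] (R → Fin α → F) × (B → E → F) × ({p : Pos α // P p} → F) :=
  (LinearMap.pi fun a : R => nodeContent Φ lam a).prod
    ((LinearMap.pi fun f : B =>
      (Φ.submatrix (Subtype.val : E → Fin N) id).mulVecLin ∘ₗ vecMulBlock (Φ f) 1).prod
        (LinearMap.funLeft F F Subtype.val))

lemma observationMap_bijective (h : IsAdmissible 0 c m Φ lam) (hmc : m ≤ c) (hcα : c ≤ α)
    {R B E : Finset (Fin N)} (hR : R.card = c) (hBR : B ⊆ R) (hB : B.card = m)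
    (hRE : Disjoint R E) (hE : E.card = α + 1 - c) :
    Function.Bijective (observationMap Φ lam R B E fun p => ¬ IsRandomPos c m p) := by
  classical
  have hinj : Function.Injective (observationMap Φ lam R B E fun p => ¬ IsRandomPos c m p) := by
    refine (injective_iff_map_eq_zero _).2 fun v hv => ?_
    obtain ⟨hcontent, horth, hmsg⟩ := by simpa only [Prod.ext_iff] using hv
    have hzero : ∀ a ∈ R, nodeContent Φ lam a v = 0 := fun a ha => congrFun hcontent ⟨a, ha⟩
    exact eq_zero_of_isRandomPos h hmc hcα hR hB (fun p hp => congrFun hmsg ⟨p, hp⟩) hzero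
      fun f hf => vecMulBlock_eq_zero_of_orthogonal h.phi_indep h.lam_injective hRE (by omega)
        hzero (hBR hf) fun e he => congrFun (congrFun horth ⟨f, hf⟩) ⟨e, he⟩
  refine ⟨hinj, (LinearMap.injective_iff_surjective_of_finrank_eq_finrank ?_).1 hinj⟩
  have hcount := card_isRandomPos_add_card_not_isRandomPos (α := α) c m
  rw [card_isRandomPos hmc hcα, Nat.card_eq_fintype_card, Nat.card_eq_fintype_card] at hcount
  simp only [Module.finrank_prod, Module.finrank_pi_fintype, Module.finrank_self,
    Finset.sum_const, Finset.card_univ, Fintype.card_coe, Fintype.card_fin, hR, hB, hE,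
    smul_eq_mul, mul_one]
  linarith

lemma existsUnique_filling (h : IsAdmissible 0 c m Φ lam) (hmc : m ≤ c) (hcα : c ≤ α) (hαN : α < N)
    {R B : Finset (Fin N)} (hR : R.card = c) (hBR : B ⊆ R) (hB : B.card = m)
    (u : {p : Pos α // ¬ IsRandomPos c m p} → F) :
    ∃! v : Pos α → F, (∀ p, v p.1 = u p) ∧ (∀ a ∈ R, nodeContent Φ lam a v = 0) ∧
      ∀ f ∈ B, vecMulBlock (Φ f) 1 v = 0 := by
  obtain ⟨E, hER, hE⟩ := Finset.exists_subset_card_eq (s := Rᶜ) (n := α + 1 - c)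
    (by rw [Finset.card_compl, hR, Fintype.card_fin]; omega)
  have hRE : Disjoint R E := Finset.subset_compl_iff_disjoint_left.1 hER
  refine (existsUnique_congr fun v => ?_).1
    ((observationMap_bijective h hmc hcα hR hBR hB hRE hE).existsUnique (0, 0, u))
  simp only [Prod.ext_iff]
  constructor
  · rintro ⟨hcontent, horth, hmsg⟩
    have hzero : ∀ a ∈ R, nodeContent Φ lam a v = 0 := fun a ha => congrFun hcontent ⟨a, ha⟩
    exact ⟨congrFun hmsg, hzero, fun f hf => vecMulBlock_eq_zero_of_orthogonal h.phi_indep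
      h.lam_injective hRE (by omega) hzero (hBR hf)
      fun e he => congrFun (congrFun horth ⟨f, hf⟩) ⟨e, he⟩⟩
  · rintro ⟨hmsg, hzero, hrow⟩
    refine ⟨funext fun a => hzero a a.2, funext fun f => funext fun e => ?_, funext hmsg⟩
    exact (congrArg (Φ e ⬝ᵥ ·) (hrow f f.2)).trans (dotProduct_zero (Φ e))

end Filling

section Shortening

variable {F : Type*} [Field F] {n α i ℓ m : ℕ}

/-- The `i` removed nodes together with the nodes in `K`, as nodes of the longer code. -/
def withRemoved (i : ℕ) (K : Finset (Fin n)) : Finset (Fin (i + n)) :=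
  (Finset.univ.disjSum K).map finSumFinEquiv.toEmbedding

lemma forall_mem_withRemoved {K : Finset (Fin n)} {p : Fin (i + n) → Prop} :
    (∀ a ∈ withRemoved i K, p a) ↔
      (∀ j : Fin i, p (Fin.castAdd n j)) ∧ ∀ j ∈ K, p (Fin.natAdd i j) := by
  simp only [withRemoved, Finset.forall_mem_map, Sum.forall, Finset.inl_mem_disjSum,
    Finset.inr_mem_disjSum, Finset.mem_univ, forall_const, Equiv.coe_toEmbedding,
    finSumFinEquiv_apply_left, finSumFinEquiv_apply_right]

lemma map_natAddEmb_subset_withRemoved (K : Finset (Fin n)) :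
    K.map (Fin.natAddEmb i) ⊆ withRemoved i K := by
  simp only [Finset.subset_iff, Finset.forall_mem_map]
  exact (forall_mem_withRemoved (p := (· ∈ withRemoved i K)).1 fun _ => id).2

lemma card_withRemoved (i : ℕ) (K : Finset (Fin n)) : (withRemoved i K).card = i + K.card := by
  rw [withRemoved, Finset.card_map, Finset.card_disjSum, Finset.card_fin]

lemma shortenedCodeMatrix_row (Φ : Matrix (Fin (i + n)) (Fin α) F) (lam : Fin (i + n) → F)
    (v : Pos α → F) (j : Fin n) :
    shortenedCodeMatrix Φ lam v j = nodeContent Φ lam (Fin.natAdd i j) v := by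
  rw [shortenedCodeMatrix, codeMatrix_row]
  rfl

lemma shortenedCodeMatrix_sub (Φ : Matrix (Fin (i + n)) (Fin α) F) (lam : Fin (i + n) → F)
    (v w : Pos α → F) : shortenedCodeMatrix Φ lam (v - w) =
      shortenedCodeMatrix Φ lam v - shortenedCodeMatrix Φ lam w := by
  ext j b
  simp only [Matrix.sub_apply, shortenedCodeMatrix_row, map_sub, Pi.sub_apply]

lemma repairSymbol_sub (Φ C D : Matrix (Fin n) (Fin α) F) (f j : Fin n) :
    repairSymbol Φ (C - D) f j = repairSymbol Φ C f j - repairSymbol Φ D f j :=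
  sub_dotProduct _ _ _

lemma repairSymbol_shortened (Φ : Matrix (Fin (i + n)) (Fin α) F) (lam : Fin (i + n) → F)
    (v : Pos α → F) (f j : Fin n) :
    repairSymbol (lastRows Φ) (shortenedCodeMatrix Φ lam v) f j =
      nodeContent Φ lam (Fin.natAdd i j) v ⬝ᵥ Φ (Fin.natAdd i f) := by
  rw [repairSymbol, shortenedCodeMatrix_row]
  rfl

lemma view_sub (Φ : Matrix (Fin n) (Fin α) F) (A : Finset (Fin n))
    (T : Finset (Fin n × Finset (Fin n))) (C D : Matrix (Fin n) (Fin α) F) :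
    view Φ A T (C - D) = view Φ A T C - view Φ A T D :=
  Prod.ext rfl (funext fun _ => funext fun _ => repairSymbol_sub _ _ _ _ _)

variable {Φ : Matrix (Fin (i + n)) (Fin α) F} {lam : Fin (i + n) → F}

lemma isShortenedFilling_iff {u : MsgPos α i ℓ m → F} {r : RandPos α i ℓ m → F} {v : Pos α → F} :
    IsShortenedFilling Φ lam u r v ↔ (∀ p : MsgPos α i ℓ m, v p = u p) ∧
      (∀ p : RandPos α i ℓ m, v p = r p) ∧
      ∀ j : Fin i, nodeContent Φ lam (Fin.castAdd n j) v = 0 := by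
  simp only [← codeMatrix_row]
  exact ⟨fun h => ⟨h.message, h.random, h.zero⟩, fun h => ⟨h.1, h.2.1, h.2.2⟩⟩

lemma IsShortenedFilling.nodeContent_eq_zero {u : MsgPos α i ℓ m → F} {r : RandPos α i ℓ m → F}
    {v : Pos α → F} (h : IsShortenedFilling Φ lam u r v) (j : Fin i) :
    nodeContent Φ lam (Fin.castAdd n j) v = 0 :=
  (isShortenedFilling_iff.1 h).2.2 j

lemma IsShortenedFilling.sub {u u' : MsgPos α i ℓ m → F} {r r' : RandPos α i ℓ m → F}
    {v v' : Pos α → F} (h : IsShortenedFilling Φ lam u r v)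
    (h' : IsShortenedFilling Φ lam u' r' v') :
    IsShortenedFilling Φ lam (u - u') (r - r') (v - v') :=
  isShortenedFilling_iff.2
    ⟨fun p => by simp only [Pi.sub_apply, h.message, h'.message],
      fun p => by simp only [Pi.sub_apply, h.random, h'.random],
      fun j => by rw [map_sub, h.nodeContent_eq_zero, h'.nodeContent_eq_zero, sub_zero]⟩

lemma forall_unforced_iff {p : Pos α → Prop} :
    (∀ x, ¬ IsRandomPos i 0 x → p x) ↔
      (∀ x : MsgPos α i ℓ m, p x) ∧ ∀ x : RandPos α i ℓ m, p x := by
  simp only [← isForcedPos_iff_isRandomPos, Subtype.forall]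
  refine ⟨fun h => ⟨fun x hx => h x fun hf => hx (hf.isRandomPos ℓ m), fun x hx => h x hx.2⟩,
    fun h x hf => ?_⟩
  by_cases hx : IsRandomPos (ℓ + i) m x
  · exact h.2 x ⟨hx, hf⟩
  · exact h.1 x hx

lemma existsUnique_shortenedFilling (h : IsAdmissible i ℓ m Φ lam) (hiα : i ≤ α) (hα : α < i + n)
    (u : MsgPos α i ℓ m → F) (r : RandPos α i ℓ m → F) :
    ∃! v, IsShortenedFilling Φ lam u r v := by
  classical
  let w : Pos α → F := fun p =>
    if hp : IsRandomPos (ℓ + i) m p then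
      if hf : IsForcedPos i p then 0 else r ⟨p, hp, hf⟩
    else u ⟨p, hp⟩
  have hwu : ∀ p : MsgPos α i ℓ m, w p = u p := fun p => dif_neg p.2
  have hwr : ∀ p : RandPos α i ℓ m, w p = r p := fun p =>
    (dif_pos p.2.1).trans (dif_neg p.2.2)
  refine (existsUnique_congr fun v => ?_).1
    (existsUnique_filling h.forced (Nat.zero_le i) hiα hα (R := withRemoved i ∅)
      (by rw [card_withRemoved, Finset.card_empty, add_zero]) (Finset.empty_subset _)
      Finset.card_empty fun p => w p)
  rw [Subtype.forall, forall_unforced_iff (ℓ := ℓ) (m := m) (p := fun x => v x = w x),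
    isShortenedFilling_iff, forall_mem_withRemoved, and_assoc]
  simp only [hwu, hwr, Finset.notMem_empty, false_imp_iff, implies_true, and_true]

lemma IsShortenedFilling.eq_zero_of_contents (h : IsAdmissible i ℓ m Φ lam)
    {u : MsgPos α i ℓ m → F} {r : RandPos α i ℓ m → F} {v : Pos α → F}
    (hv : IsShortenedFilling Φ lam u r v) {K : Finset (Fin n)} (hK : i + K.card = α + 1)
    (hzero : ∀ j ∈ K, shortenedCodeMatrix Φ lam v j = 0) : v = 0 :=
  eq_zero_of_nodeContent_eq_zero h.phi_indep h.lam_injective ((card_withRemoved i K).trans hK)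
    (forall_mem_withRemoved.2 ⟨hv.nodeContent_eq_zero,
      fun j hj => (shortenedCodeMatrix_row Φ lam v j).symm.trans (hzero j hj)⟩)

lemma IsShortenedFilling.content_eq_zero_of_repair (h : IsAdmissible i ℓ m Φ lam)
    {u : MsgPos α i ℓ m → F} {r : RandPos α i ℓ m → F} {v : Pos α → F}
    (hv : IsShortenedFilling Φ lam u r v) {H : Finset (Fin n)} (hH : i + H.card = 2 * α)
    {f : Fin n} (hzero : ∀ j ∈ H,
      repairSymbol (lastRows Φ) (shortenedCodeMatrix Φ lam v) f j = 0) :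
    shortenedCodeMatrix Φ lam v f = 0 := by
  rw [shortenedCodeMatrix_row]
  refine nodeContent_eq_zero_of_repair h.psi_indep ((card_withRemoved i H).trans hH)
    (forall_mem_withRemoved.2 ⟨fun j => ?_, fun j hj => ?_⟩)
  · rw [hv.nodeContent_eq_zero, zero_dotProduct]
  · rw [← repairSymbol_shortened, hzero j hj]

lemma exists_shortenedFilling_view_eq_zero (h : IsAdmissible i ℓ m Φ lam) (hm : m ≤ ℓ)
    (hℓα : ℓ + i ≤ α) (hα : α < i + n) {A B : Finset (Fin n)} (hA : A.card ≤ ℓ) (hBA : B ⊆ A)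
    (hB : B.card ≤ m) {T : Finset (Fin n × Finset (Fin n))} (hT : ∀ t ∈ T, t.1 ∈ B)
    (u : MsgPos α i ℓ m → F) :
    ∃ r v, IsShortenedFilling Φ lam u r v ∧
      view (lastRows Φ) A T (shortenedCodeMatrix Φ lam v) = 0 := by
  obtain ⟨A', hAA', hA'⟩ := Finset.exists_superset_card_eq hA (by rw [Fintype.card_fin]; omega)
  obtain ⟨B', hBB', hBA', hB'⟩ :=
    Finset.exists_subsuperset_card_eq (hBA.trans hAA') hB (hm.trans hA'.ge)
  obtain ⟨v, ⟨hv, hzero, hrow⟩, -⟩ := existsUnique_filling h.longer (by omega) hℓα hα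
    (by rw [card_withRemoved, hA', add_comm])
    ((Finset.map_subset_map.2 hBA').trans (map_natAddEmb_subset_withRemoved A'))
    ((Finset.card_map _).trans hB') u
  have hzero' := forall_mem_withRemoved.1 hzero
  refine ⟨fun p => v p, v, isShortenedFilling_iff.2 ⟨hv, fun p => rfl, hzero'.1⟩, Prod.ext ?_ ?_⟩
  · funext a
    exact (shortenedCodeMatrix_row Φ lam v a).trans (hzero'.2 a (hAA' a.2))
  · funext t j
    have hf : t.1.1 ∈ B' := hBB' (hT t t.2)
    have hS₂ : vecMulBlock (Φ (Fin.natAdd i t.1.1)) 1 v = 0 :=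
      hrow _ (Finset.mem_map_of_mem (Fin.natAddEmb i) hf)
    exact (repairSymbol_shortened Φ lam v t.1.1 j).trans
      (nodeContent_dotProduct_eq_zero (hzero'.2 _ (hBA' hf)) hS₂ _)

end Shortening

section Properties

variable {F : Type*} [Field F] {n α i ℓ m : ℕ} {Φ : Matrix (Fin (i + n)) (Fin α) F}
  {lam : Fin (i + n) → F} {fill : (MsgPos α i ℓ m → F) → (RandPos α i ℓ m → F) → (Pos α → F)}

lemma reconstructs_shortened (h : IsAdmissible i ℓ m Φ lam)
    (hfill : ∀ u r, IsShortenedFilling Φ lam u r (fill u r)) {k : ℕ} (hk : i + k = α + 1) :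
    Reconstructs k fun u r => shortenedCodeMatrix Φ lam (fill u r) := by
  intro K hK
  have hfac : Function.FactorsThrough
      (fun x : (MsgPos α i ℓ m → F) × (RandPos α i ℓ m → F) => x.1)
      fun x (j : K) => shortenedCodeMatrix Φ lam (fill x.1 x.2) j := by
    rintro ⟨u, r⟩ ⟨u', r'⟩ hview
    have hdiff := (hfill u r).sub (hfill u' r')
    have hzero := hdiff.eq_zero_of_contents h (hK.symm ▸ hk) fun j hj => by
      rw [shortenedCodeMatrix_sub]
      exact sub_eq_zero.2 (congrFun hview ⟨j, hj⟩)
    exact funext fun p => sub_eq_zero.1 ((hdiff.message p).symm.trans (congrFun hzero p))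
  exact ⟨Function.extend _ _ 0, fun u r => hfac.extend_apply 0 (u, r)⟩

lemma repairs_shortened (h : IsAdmissible i ℓ m Φ lam)
    (hfill : ∀ u r, IsShortenedFilling Φ lam u r (fill u r)) {d : ℕ} (hd : i + d = 2 * α) :
    Repairs d (lastRows Φ) fun u r => shortenedCodeMatrix Φ lam (fill u r) := by
  intro f H _ hH
  have hfac : Function.FactorsThrough
      (fun x : (MsgPos α i ℓ m → F) × (RandPos α i ℓ m → F) =>
        shortenedCodeMatrix Φ lam (fill x.1 x.2) f)
      fun x (j : H) =>
        repairSymbol (lastRows Φ) (shortenedCodeMatrix Φ lam (fill x.1 x.2)) f j := by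
    rintro ⟨u, r⟩ ⟨u', r'⟩ hview
    have hzero := ((hfill u r).sub (hfill u' r')).content_eq_zero_of_repair h (hH.symm ▸ hd)
      fun j hj => by
        rw [shortenedCodeMatrix_sub, repairSymbol_sub]
        exact sub_eq_zero.2 (congrFun hview ⟨j, hj⟩)
    rw [shortenedCodeMatrix_sub] at hzero
    exact sub_eq_zero.1 hzero
  exact ⟨Function.extend _ _ 0, fun u r => hfac.extend_apply 0 (u, r)⟩

end Properties

section Information

lemma map_equiv_uniformOn_univ {X Y : Type*} [Finite X] [MeasurableSpace X]
    [MeasurableSingletonClass X] [MeasurableSpace Y] [MeasurableSingletonClass Y] (e : X ≃ Y) :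
    (ProbabilityTheory.uniformOn (Set.univ : Set X)).map e =
      ProbabilityTheory.uniformOn Set.univ := by
  have := Fintype.ofFinite X
  have := Fintype.ofEquiv X e
  ext s hs
  rw [Measure.map_apply (measurable_of_finite e) hs, ProbabilityTheory.uniformOn_univ,
    ProbabilityTheory.uniformOn_univ, ← e.image_symm_eq_preimage,
    Measure.count_injective_image e.symm.injective, Fintype.card_congr e]

lemma mutualInfo_fst_eq_zero {U R Y : Type*} [MeasurableSpace U] [MeasurableSpace R]
    [MeasurableSpace Y] {ν : Measure U} {μ : Measure R} [IsProbabilityMeasure ν]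
    [IsProbabilityMeasure μ] {g : U → R → Y} (hg : Measurable (Function.uncurry g))
    {κ : Measure Y} (hκ : ∀ u, μ.map (g u) = κ) :
    mutualInfo (ν.prod μ) (fun ω => ω.1) (fun ω => g ω.1 ω.2) = 0 := by
  obtain ⟨u₀⟩ : Nonempty U := nonempty_of_isProbabilityMeasure ν
  have : IsProbabilityMeasure κ := by
    rw [← hκ u₀]
    exact Measure.isProbabilityMeasure_map (hg.comp measurable_prodMk_left).aemeasurable
  have hjoint := (MeasurePreserving.id ν).skew_product hg (Filter.Eventually.of_forall hκ)
  have hsnd : (ν.prod μ).map (fun ω => g ω.1 ω.2) = κ := by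
    have := congrArg (Measure.map Prod.snd) hjoint.map_eq
    rw [Measure.map_map measurable_snd hjoint.measurable] at this
    exact this.trans Measure.snd_prod
  have hfst : (ν.prod μ).map (fun ω => ω.1) = ν := Measure.fst_prod
  rw [mutualInfo, hfst, hsnd]
  exact (congrArg₂ _ hjoint.map_eq rfl).trans (InformationTheory.klDiv_self _)

lemma mutualInfo_eq_zero_of_pad {U R Y : Type*} [MeasurableSpace U] [Finite U]
    [MeasurableSingletonClass U] [AddGroup R] [Finite R] [MeasurableSpace R]
    [MeasurableSingletonClass R] [MeasurableSpace Y] (ν : Measure U) [IsProbabilityMeasure ν]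
    {g : U → R → Y} (g₀ : R → Y) (pad : U → R) (hg : ∀ u r, g u r = g₀ (r - pad u)) :
    mutualInfo (ν.prod (ProbabilityTheory.uniformOn Set.univ)) (fun ω => ω.1)
      (fun ω => g ω.1 ω.2) = 0 := by
  have : IsProbabilityMeasure (ProbabilityTheory.uniformOn (Set.univ : Set R)) :=
    ProbabilityTheory.isProbabilityMeasure_uniformOn Set.finite_univ Set.univ_nonempty
  refine mutualInfo_fst_eq_zero (measurable_of_finite _)
    (κ := (ProbabilityTheory.uniformOn Set.univ).map g₀) fun u => ?_
  conv_rhs => rw [← map_equiv_uniformOn_univ (Equiv.subRight (pad u))]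
  rw [Measure.map_map (measurable_of_finite _) (measurable_of_finite _)]
  exact congrArg (Measure.map · _) (funext (hg u))

lemma isSecure_shortened {F : Type*} [Field F] [Finite F] [MeasurableSpace F]
    [MeasurableSingletonClass F] {n α i ℓ m : ℕ} {Φ : Matrix (Fin (i + n)) (Fin α) F}
    {lam : Fin (i + n) → F} (h : IsAdmissible i ℓ m Φ lam) (hm : m ≤ ℓ) (hℓα : ℓ + i ≤ α)
    (hα : α < i + n) {fill : (MsgPos α i ℓ m → F) → (RandPos α i ℓ m → F) → (Pos α → F)}
    (hfill : ∀ u r v, IsShortenedFilling Φ lam u r v ↔ v = fill u r) (d : ℕ) :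
    IsSecure ℓ m d (lastRows Φ) fun u r => shortenedCodeMatrix Φ lam (fill u r) := by
  intro A B T hA hBA hB hT ν _
  choose pad v hv hview using
    exists_shortenedFilling_view_eq_zero h hm hℓα hα hA hBA hB fun t ht => (hT t ht).1
  refine mutualInfo_eq_zero_of_pad ν
    (g := fun u r => view (lastRows Φ) A T (shortenedCodeMatrix Φ lam (fill u r)))
    (fun r => view (lastRows Φ) A T (shortenedCodeMatrix Φ lam (fill 0 r))) pad fun u r => ?_
  have hdiff : fill u r - v u = fill 0 (r - pad u) := by
    rw [← sub_self u]
    exact (hfill _ _ _).1 (((hfill u r _).2 rfl).sub (hv u))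
  rw [← hdiff, shortenedCodeMatrix_sub, view_sub, hview, sub_zero]

end Information

end SecureMSR

theorem mainTheorem8_general {F : Type*} [Field F] [Finite F] [MeasurableSpace F]
    [MeasurableSingletonClass F] (n k i ℓ m : ℕ) (hℓ : ℓ < k) (hm : m ≤ ℓ) (hn : k ≤ n) :
    Nat.card (MsgPos (k - 1 + i) i ℓ m) = (k - ℓ) * (k - 1 + i - m) ∧
    Nat.card (RandPos (k - 1 + i) i ℓ m) = ℓ * (k - 1 + i) + (k - ℓ) * m ∧
    Nat.card (MsgPos (k - 1 + i) i ℓ m) + Nat.card (RandPos (k - 1 + i) i ℓ m)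
      = k * (k - 1 + i) ∧
    Nat.card {p : Pos (k - 1 + i) // IsForcedPos i p} = i * (k - 1 + i) ∧
    (∀ p : Pos (k - 1 + i), IsForcedPos i p → IsRandomPos (ℓ + i) m p) ∧
    (∀ x : Fin (i + n) → F, (Function.Injective fun j => x j ^ (k - 1 + i)) →
      IsAdmissible i ℓ m (vandermondePhi (k - 1 + i) x) (fun j => x j ^ (k - 1 + i))) ∧
    ∀ (Φ : Matrix (Fin (i + n)) (Fin (k - 1 + i)) F) (lam : Fin (i + n) → F),
      IsAdmissible i ℓ m Φ lam →
      ∃ fill : (MsgPos (k - 1 + i) i ℓ m → F) → (RandPos (k - 1 + i) i ℓ m → F) →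
          (Pos (k - 1 + i) → F),
        (∀ u r v, IsShortenedFilling Φ lam u r v ↔ v = fill u r) ∧
        Reconstructs k (fun u r => shortenedCodeMatrix Φ lam (fill u r)) ∧
        Repairs (2 * k - 2 + i) (lastRows Φ) (fun u r => shortenedCodeMatrix Φ lam (fill u r)) ∧
        IsSecure ℓ m (2 * k - 2 + i) (lastRows Φ)
          (fun u r => shortenedCodeMatrix Φ lam (fill u r)) := by
  have hk : k - 1 + i + 1 - (ℓ + i) = k - ℓ := by omega
  have hmsg := card_not_isRandomPos (α := k - 1 + i) (c := ℓ + i) (m := m) (by omega) (by omega)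
  have hrand := card_randPos (α := k - 1 + i) (i := i) hm (by omega)
  rw [hk] at hmsg hrand
  refine ⟨hmsg, hrand, ?_, card_isForcedPos (by omega), fun p hp => hp.isRandomPos ℓ m,
    fun x hx => vandermonde_isAdmissible hm (by omega) hx, fun Φ lam h => ?_⟩
  · rw [hmsg, hrand, add_left_comm, ← mul_add, Nat.sub_add_cancel (by omega), ← add_mul,
      Nat.add_sub_cancel' hℓ.le]
  choose fill hfill huniq using existsUnique_shortenedFilling h (by omega) (by omega)
  have hfill_iff : ∀ u r v, IsShortenedFilling Φ lam u r v ↔ v = fill u r :=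
    fun u r v => ⟨huniq u r v, fun hv => hv ▸ hfill u r⟩
  exact ⟨fill, hfill_iff, reconstructs_shortened h hfill (by omega),
    repairs_shortened h hfill (by omega), isSecure_shortened h hm (by omega) (by omega) hfill_iff _⟩

theorem mainTheorem8 {F : Type*} [Field F] [Finite F] [MeasurableSpace F]
    [MeasurableSingletonClass F] (n k i ℓ m : ℕ) (hi : 1 ≤ i) (hℓ : ℓ < k) (hm : m ≤ ℓ)
    (hn : 2 * k - 2 + i < n) :
    -- numbers of message symbols, of remaining random symbols and of deterministic symbols
    Nat.card (MsgPos (k - 1 + i) i ℓ m) = (k - ℓ) * (k - 1 + i - m) ∧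
    Nat.card (RandPos (k - 1 + i) i ℓ m) = ℓ * (k - 1 + i) + (k - ℓ) * m ∧
    Nat.card (MsgPos (k - 1 + i) i ℓ m) + Nat.card (RandPos (k - 1 + i) i ℓ m)
      = k * (k - 1 + i) ∧
    Nat.card {p : Pos (k - 1 + i) // IsForcedPos i p} = i * (k - 1 + i) ∧
    (∀ p : Pos (k - 1 + i), IsForcedPos i p → IsRandomPos (ℓ + i) m p) ∧
    -- the Vandermonde choice of the encoding matrix is admissible
    (∀ x : Fin (i + n) → F, (Function.Injective fun j => x j ^ (k - 1 + i)) →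
      IsAdmissible i ℓ m (vandermondePhi (k - 1 + i) x) (fun j => x j ^ (k - 1 + i))) ∧
    -- the shortened code exists, is an `[n, k, d = 2k - 2 + i]` code and is secure
    ∀ (Φ : Matrix (Fin (i + n)) (Fin (k - 1 + i)) F) (lam : Fin (i + n) → F),
      IsAdmissible i ℓ m Φ lam →
      ∃ fill : (MsgPos (k - 1 + i) i ℓ m → F) → (RandPos (k - 1 + i) i ℓ m → F) →
          (Pos (k - 1 + i) → F),
        (∀ u r v, IsShortenedFilling Φ lam u r v ↔ v = fill u r) ∧
        Reconstructs k (fun u r => shortenedCodeMatrix Φ lam (fill u r)) ∧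
        Repairs (2 * k - 2 + i) (lastRows Φ) (fun u r => shortenedCodeMatrix Φ lam (fill u r)) ∧
        IsSecure ℓ m (2 * k - 2 + i) (lastRows Φ)
          (fun u r => shortenedCodeMatrix Φ lam (fill u r)) :=
  mainTheorem8_general n k i ℓ m hℓ hm (by omega)
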